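/- Let $k$ be a field, $n\ge 0$, and let $S=k[x_0,\dots,x_n]$ with its standard grading. Let $F=Se_1\oplus\cdots\oplus Se_r$ be a graded free $S$-module of finite rank $r\ge 0$ whose generators have integer degrees $\deg e_i=f_i\le 0$, and let $M\subseteq F$ be a graded $S$-submodule. The Hilbert polynomial of $F/M$ is the polynomial $P_{F/M}\in\mathbb{Q}[d]$ such that $P_{F/M}(d)=\dim_k (F/M)_d$ for all sufficiently large integers $d$. A Gotzmann representation of a polynomial $P\in\mathbb{Q}[d]$ is a finite (possibly empty) sequence of integers $a_1\ge a_2\ge\cdots\ge a_s\ge 0$ such that $$P(d)=\sum_{j=1}^{s}\binom{d+a_j-(j-1)}{d-(j-1)},$$ where $\binom{d+a_j-(j-1)}{d-(j-1)}=\binom{d+a_j-(j-1)}{a_j}$ is read as a polynomial in $d$ of degree $a_j$; the empty sequence represents $P=0$. Then $F/M$ has a unique Hilbert polynomial $P_{F/M}$, and $P_{F/M}$ has a unique Gotzmann representation. The condition $f_i\le 0$ cannot be dropped: over $S=k[x_0,x_1]$, the free module $S(-1)$ on one generator of degree $1$, whose associated sheaf is $\mathcal{O}_{\mathbb{P}^1}(-1)$,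 has the Hilbert polynomial $P(d)=d$, which has no Gotzmann representation. -/

import Mathlib

open MvPolynomial

namespace Gotzmann

/-- The degree-`d` part of the graded free module `F = S e₁ ⊕ ⋯ ⊕ S e_r` over the standard graded
polynomial ring `S = k[x₀, …, x_n]`, where `deg eᵢ = f i`. An element `∑ vᵢ eᵢ` is homogeneous of
degree `d` if and only if every `vᵢ` is homogeneous of degree `d - f i` (and so `vᵢ = 0` if
`d < f i`). All variables have the weight `1 : ℤ`. -/
noncomputable def freePiece (k : Type*) [Field k] (n : ℕ) {r : ℕ} (f : Fin r → ℤ) (d : ℤ) :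
    Submodule k (Fin r → MvPolynomial (Fin (n + 1)) k) :=
  Submodule.pi Set.univ fun i =>
    weightedHomogeneousSubmodule k (fun _ : Fin (n + 1) => (1 : ℤ)) (d - f i)

/-- The homogeneous component of degree `d` of an element of `F`. -/
noncomputable def freeComponent {k : Type*} [Field k] {n r : ℕ} (f : Fin r → ℤ) (d : ℤ)
    (v : Fin r → MvPolynomial (Fin (n + 1)) k) : Fin r → MvPolynomial (Fin (n + 1)) k :=
  fun i => weightedHomogeneousComponent (fun _ : Fin (n + 1) => (1 : ℤ)) (d - f i) (v i)

theorem freeComponent_mem {k : Type*} [Field k] {n r : ℕ} (f : Fin r → ℤ) (d : ℤ)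
    (v : Fin r → MvPolynomial (Fin (n + 1)) k) : freeComponent f d v ∈ freePiece k n f d := by
  intro i _
  exact weightedHomogeneousComponent_mem _ _ _

/-- An `S`-submodule `M` of `F` is graded if it contains all the homogeneous components of each of
its elements. -/
def IsGradedSubmodule {k : Type*} [Field k] {n r : ℕ} (f : Fin r → ℤ)
    (M : Submodule (MvPolynomial (Fin (n + 1)) k) (Fin r → MvPolynomial (Fin (n + 1)) k)) : Prop :=
  ∀ v ∈ M, ∀ d : ℤ, freeComponent f d v ∈ M

/-- The degree-`d` part of `F / M`: the image of the degree-`d` part of `F`. -/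
noncomputable def quotientPiece {k : Type*} [Field k] {n r : ℕ} (f : Fin r → ℤ)
    (M : Submodule (MvPolynomial (Fin (n + 1)) k) (Fin r → MvPolynomial (Fin (n + 1)) k))
    (d : ℤ) : Submodule k ((Fin r → MvPolynomial (Fin (n + 1)) k) ⧸ M) :=
  (freePiece k n f d).map (M.mkQ.restrictScalars k)

/-- The Hilbert function `d ↦ dim_k (F / M)_d`. -/
noncomputable def hilbertFunction {k : Type*} [Field k] {n r : ℕ} (f : Fin r → ℤ)
    (M : Submodule (MvPolynomial (Fin (n + 1)) k) (Fin r → MvPolynomial (Fin (n + 1)) k))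
    (d : ℤ) : ℕ :=
  Module.finrank k (quotientPiece f M d)

/-- `P` is the Hilbert polynomial of `F / M`: it agrees with the Hilbert function in all
sufficiently large degrees. -/
def IsHilbertPolynomial {k : Type*} [Field k] {n r : ℕ} (f : Fin r → ℤ)
    (M : Submodule (MvPolynomial (Fin (n + 1)) k) (Fin r → MvPolynomial (Fin (n + 1)) k))
    (P : Polynomial ℚ) : Prop :=
  ∃ d₀ : ℤ, ∀ d : ℤ, d₀ ≤ d → P.eval (d : ℚ) = (hilbertFunction f M d : ℚ)

/-- The binomial coefficient `(d + a - i choose d - i) = (d + a - i choose a)` as a polynomial in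
`d`, namely `(d - i + 1) (d - i + 2) ⋯ (d - i + a) / a!`. -/
noncomputable def binomialTerm (a i : ℕ) : Polynomial ℚ :=
  Polynomial.preHilbertPoly ℚ a i

theorem binomialTerm_eval (a i d : ℕ) (h : i ≤ d) :
    (binomialTerm a i).eval (d : ℚ) = ((d + a - i).choose (d - i) : ℕ) := by
  rw [binomialTerm, Polynomial.preHilbertPoly_eq_choose_sub_add ℚ a h,
    show d + a - i = (d - i) + a by omega, Nat.choose_symm_add]

/-- The finite sequence `a₁, …, a_s` is a Gotzmann representation of `P`: it satisfies
`a₁ ≥ ⋯ ≥ a_s ≥ 0` and `P(d) = ∑ⱼ (d + aⱼ - (j - 1) choose d - (j - 1))`. Here `aⱼ` is the list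
entry with index `i = j - 1`; the empty sequence represents `0`. -/
def IsGotzmannRepresentation (P : Polynomial ℚ) (a : List ℕ) : Prop :=
  a.Pairwise (fun x y => x ≥ y) ∧
    P = ∑ i : Fin a.length, binomialTerm (a.get i) (i : ℕ)

end Gotzmann

/-!
The Hilbert function of `F / M` counts standard monomials: the monomials `x ^ m e_p` that are not
congruent modulo `M` to a combination of smaller monomials of the same degree, for an order
compatible with multiplication (`hilbertFunction_eq_card`). A quotient of a standard monomial by a
variable is again standard, so the theorem reduces to the growth of order ideals of coloured
monomials.

For a weakly decreasing sequence `a₀, …, a_{s-1}` write `V d a = ∑ i, (d - i + aᵢ choose aᵢ)`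
(`macaulaySum`). The central result is Macaulay's bound, `card_le_macaulaySum_succ`: if `B` in
degree `d ≥ s` contains the shadow of `A` in degree `d + 1`, then `#B ≤ V d a` implies
`#A ≤ V (d + 1) a`. The generators of `F` have degrees `≤ 0`, so the exponent vectors occurring in
degree `d` have degree at least `d`; nothing else about the colours is used. The proof is by
induction on the number of variables. Compression along the lines `x_s ^ a x₀ ^ (e - a)` makes `B`
stable, so that each slice of `B` by the exponent of `x₀` contains the shadow of the preceding one.
The bound in fewer variables, read backwards, shows that if the slice `x₀ ∤ m` is too large then so
are all the others, and hence `B`; read forwards, it bounds the slice `x₀ ∤ m` of `A`, while the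
remaining part of `A` injects into `B`.

Macaulay's bound alone yields both the Hilbert polynomial and its representation
(`exists_eventually_eq_macaulaySum`): among all sequences `a` with `dim (F / M)_d ≤ V d a` for some
`d ≥ s`, one that is minimal for the Dershowitz–Manna order satisfies `dim (F / M)_d = V d a` for
all large `d`, and `V d a` is a polynomial in `d` for `d ≥ s`. Uniqueness follows from comparing
the growth of two such sums, entry by entry (`eq_of_macaulaySum_eq`).
-/

namespace Gotzmann

/-! ### Binomial sums -/

/-- The value in degree `d` of the binomial sum attached to `a₀, a₁, …`, namely
`∑ i, (d - i + aᵢ choose aᵢ)`, where the terms with index `i > d` are dropped. -/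
def macaulaySum : ℕ → List ℕ → ℕ
  | _, [] => 0
  | 0, _ :: _ => 1
  | d + 1, a :: l => (d + 1 + a).choose a + macaulaySum d l

@[simp] theorem macaulaySum_nil (d : ℕ) : macaulaySum d [] = 0 := by
  cases d <;> rfl

@[simp] theorem macaulaySum_zero_cons (a : ℕ) (l : List ℕ) : macaulaySum 0 (a :: l) = 1 := rfl

@[simp] theorem macaulaySum_succ_cons (d a : ℕ) (l : List ℕ) :
    macaulaySum (d + 1) (a :: l) = (d + 1 + a).choose a + macaulaySum d l := rfl

theorem macaulaySum_succ_map_succ (d : ℕ) (b : List ℕ) :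
    macaulaySum (d + 1) (b.map Nat.succ) =
      macaulaySum d (b.map Nat.succ) + macaulaySum (d + 1) b := by
  induction b generalizing d with
  | nil => simp
  | cons c l ih =>
    have h : (d + 1 + (c + 1)).choose (c + 1) =
        (d + 1 + c).choose c + (d + (c + 1)).choose (c + 1) := by
      rw [show d + 1 + (c + 1) = (d + 1 + c) + 1 by ring, Nat.choose_succ_succ,
        show d + (c + 1) = d + 1 + c by ring]
    cases d with
    | zero => cases l <;> simp_all <;> omega
    | succ d =>
      have := ih d
      simp only [List.map_cons, macaulaySum_succ_cons, Nat.succ_eq_add_one] at *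
      omega

theorem sum_range_macaulaySum (d : ℕ) (b : List ℕ) :
    ∑ j ∈ Finset.range (d + 1), macaulaySum j b = macaulaySum d (b.map Nat.succ) := by
  induction d with
  | zero => cases b <;> simp
  | succ d ih => rw [Finset.sum_range_succ, ih, macaulaySum_succ_map_succ]

theorem macaulaySum_replicate_zero (d z : ℕ) (h : z ≤ d) :
    macaulaySum d (List.replicate z 0) = z := by
  induction z generalizing d with
  | zero => simp
  | succ z ih =>
    obtain ⟨d, rfl⟩ : ∃ e, d = e + 1 := ⟨d - 1, by omega⟩
    simp [List.replicate_succ, ih d (by omega), add_comm]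

theorem macaulaySum_append (d : ℕ) (l m : List ℕ) (h : l.length ≤ d) :
    macaulaySum d (l ++ m) = macaulaySum d l + macaulaySum (d - l.length) m := by
  induction l generalizing d with
  | nil => simp
  | cons a l ih =>
    obtain ⟨d, rfl⟩ : ∃ e, d = e + 1 := ⟨d - 1, by simp at h; omega⟩
    simp [ih d (by simpa using h), add_assoc]

theorem macaulaySum_take_le (d j : ℕ) (l : List ℕ) :
    macaulaySum d (l.take j) ≤ macaulaySum d l := by
  induction l generalizing d j with
  | nil => simp
  | cons a l ih =>
    cases j with
    | zero => simp
    | succ j => cases d with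
      | zero => simp
      | succ d => simpa using ih d j

theorem macaulaySum_le_take_add_one (d : ℕ) (l : List ℕ) :
    macaulaySum d l ≤ macaulaySum d (l.take d) + 1 := by
  induction d generalizing l with
  | zero => cases l <;> simp
  | succ d ih => cases l with
    | nil => simp
    | cons a l => simpa [add_assoc] using ih l

theorem exists_eq_map_succ_append_replicate_zero (l : List ℕ)
    (h : l.Pairwise (fun x y => x ≥ y)) :
    ∃ (b : List ℕ) (z : ℕ), b.Pairwise (fun x y => x ≥ y) ∧
      l = b.map Nat.succ ++ List.replicate z 0 := by
  induction l with
  | nil => exact ⟨[], 0, by simp, by simp⟩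
  | cons a l ih =>
    rw [List.pairwise_cons] at h
    obtain ⟨b, z, hb, rfl⟩ := ih h.2
    cases a with
    | zero =>
      have hb' : b = [] := by
        cases b with
        | nil => rfl
        | cons c b => simpa using h.1 (c + 1) (by simp)
      subst hb'
      exact ⟨[], z + 1, by simp, by simp [List.replicate_succ]⟩
    | succ a =>
      refine ⟨a :: b, z, ?_, by simp⟩
      rw [List.pairwise_cons]
      exact ⟨fun c hc => Nat.le_of_succ_le_succ (h.1 (c + 1) (by simp [hc])), hb⟩

/-- The recursion of binomial sums under passing to a hyperplane section, which lowers every entry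
by one and removes the entries `0`. -/
theorem macaulaySum_succ_eq (d z : ℕ) (b : List ℕ) (h : b.length + z ≤ d) :
    macaulaySum (d + 1) (b.map Nat.succ ++ List.replicate z 0) =
      macaulaySum d (b.map Nat.succ ++ List.replicate z 0) + macaulaySum (d + 1) b := by
  rw [macaulaySum_append _ _ _ (by simp; omega), macaulaySum_append _ _ _ (by simp; omega),
    macaulaySum_replicate_zero _ _ (by simp; omega),
    macaulaySum_replicate_zero _ _ (by simp; omega), macaulaySum_succ_map_succ]
  ring

/-- If the slices of a set, in degrees `j = 0, …, d`, are all larger than the binomial sum of `b`,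
then the set is larger than the binomial sum of any sequence with hyperplane section `b`. The truncation
of `b` to length `j` makes Macaulay's bound applicable in degree `j`. -/
theorem macaulaySum_lt_sum (d z : ℕ) (b : List ℕ) (h : b.length + z ≤ d) (t : ℕ → ℕ)
    (ht : ∀ j ≤ d, macaulaySum j (b.take j) < t j) :
    macaulaySum d (b.map Nat.succ ++ List.replicate z 0) < ∑ j ∈ Finset.range (d + 1), t j := by
  rw [macaulaySum_append _ _ _ (by simp; omega), macaulaySum_replicate_zero _ _ (by simp; omega),
    ← sum_range_macaulaySum]
  have h1 : ∑ j ∈ Finset.range (d + 1), (macaulaySum j b + if b.length ≤ j then 1 else 0) ≤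
      ∑ j ∈ Finset.range (d + 1), t j := by
    refine Finset.sum_le_sum fun j hj => ?_
    have h2 := ht j (by simpa [Nat.lt_succ_iff] using hj)
    split_ifs with h3
    · rwa [List.take_of_length_le h3] at h2
    · have := macaulaySum_le_take_add_one j b
      omega
  have h4 : ∑ j ∈ Finset.range (d + 1), (if b.length ≤ j then 1 else 0) = d + 1 - b.length := by
    rw [← Finset.card_filter, show (Finset.range (d + 1)).filter (fun j => b.length ≤ j) =
      Finset.Ico b.length (d + 1) by ext; simp [and_comm], Nat.card_Ico]
  rw [Finset.sum_add_distrib, h4] at h1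
  omega

/-! ### Compression -/

/-- `B` contains the shadow of `A`, that is, all quotients of elements of `A` by a variable dividing
them. The elements are coloured monomials: pairs of a colour in `ι`, which stands for a free
generator, and an exponent vector. -/
def ShadowSubset {ι : Type*} {n : ℕ} (A B : Finset (ι × (Fin n → ℕ))) : Prop :=
  ∀ (p : ι) (m : Fin n → ℕ) (i : Fin n), (p, m + Pi.single i 1) ∈ A → (p, m) ∈ B

/-- `B` is stable under replacing a factor `x_i` of a monomial by `x₀`. -/
def IsStable {ι : Type*} {n : ℕ} (B : Finset (ι × (Fin (n + 1) → ℕ))) : Prop :=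
  ∀ (p : ι) (m : Fin (n + 1) → ℕ) (i : Fin n),
    (p, m + Pi.single i.succ 1) ∈ B → (p, m + Pi.single 0 1) ∈ B

section Compression

/-- The exponent vector that agrees with `m` except that `x_s` has exponent `a` and `x₀` has the
exponent which restores the degree. For `a ≤ m 0 + m s` these vectors form the line of `m`. -/
def linePoint {n : ℕ} (s : Fin n) (m : Fin (n + 1) → ℕ) (a : ℕ) : Fin (n + 1) → ℕ :=
  fun j => if j = 0 then m 0 + m s.succ - a else if j = s.succ then a else m j

variable {ι : Type*} {n : ℕ} (s : Fin n)

@[simp] theorem linePoint_zero (m : Fin (n + 1) → ℕ) (a : ℕ) :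
    linePoint s m a 0 = m 0 + m s.succ - a := by simp [linePoint]

@[simp] theorem linePoint_self (m : Fin (n + 1) → ℕ) (a : ℕ) :
    linePoint s m a s.succ = a := by simp [linePoint]

theorem linePoint_of_ne (m : Fin (n + 1) → ℕ) (a : ℕ) {j : Fin (n + 1)} (h0 : j ≠ 0)
    (hs : j ≠ s.succ) : linePoint s m a j = m j := by simp [linePoint, h0, hs]

@[simp] theorem linePoint_eq (m : Fin (n + 1) → ℕ) : linePoint s m (m s.succ) = m := by
  ext j
  by_cases h0 : j = 0
  · subst h0; simp
  by_cases hs : j = s.succ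
  · subst hs; simp
  rw [linePoint_of_ne s m _ h0 hs]

theorem linePoint_linePoint (m : Fin (n + 1) → ℕ) {a : ℕ} (ha : a ≤ m 0 + m s.succ) :
    linePoint s (linePoint s m a) = linePoint s m := by
  ext b j
  by_cases h0 : j = 0
  · subst h0; simp [ha]
  by_cases hs : j = s.succ
  · subst hs; simp
  rw [linePoint_of_ne s _ _ h0 hs, linePoint_of_ne s _ _ h0 hs, linePoint_of_ne s _ _ h0 hs]

theorem sum_linePoint (m : Fin (n + 1) → ℕ) {a : ℕ} (ha : a ≤ m 0 + m s.succ) :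
    ∑ j, linePoint s m a j = ∑ j, m j := by
  have h : linePoint s m a + Pi.single s.succ (m s.succ) + Pi.single 0 (m 0) =
      m + Pi.single s.succ a + Pi.single 0 (m 0 + m s.succ - a) := by
    ext j
    by_cases h0 : j = 0
    · subst h0; simp [(Fin.succ_ne_zero s).symm]; omega
    by_cases hs : j = s.succ
    · subst hs; simp [Fin.succ_ne_zero s]; omega
    simp [linePoint_of_ne s _ _ h0 hs, h0, hs]
  have h' := congrArg (fun f : Fin (n + 1) → ℕ => ∑ j, f j) h
  simp only [Pi.add_apply, Finset.sum_add_distrib, Finset.sum_pi_single', Finset.mem_univ,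
    if_true] at h'
  omega

open Classical in
/-- The positions on the line of `m` at which `A` has an element of colour `p`. -/
noncomputable def lineFinset (A : Finset (ι × (Fin (n + 1) → ℕ))) (p : ι) (m : Fin (n + 1) → ℕ) :
    Finset ℕ :=
  (Finset.range (m 0 + m s.succ + 1)).filter fun a => (p, linePoint s m a) ∈ A

/-- The number of elements of `A` on the line of `x` with smaller `x_s`-exponent. -/
noncomputable def lineRank (A : Finset (ι × (Fin (n + 1) → ℕ))) (x : ι × (Fin (n + 1) → ℕ)) : ℕ :=
  ((lineFinset s A x.1 x.2).filter fun a => a < x.2 s.succ).card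

/-- Move an element of `A` along its line to the position given by its rank. -/
noncomputable def compressMap (A : Finset (ι × (Fin (n + 1) → ℕ))) (x : ι × (Fin (n + 1) → ℕ)) :
    ι × (Fin (n + 1) → ℕ) :=
  (x.1, linePoint s x.2 (lineRank s A x))

open Classical in
/-- The compression of `A`: on every line, the elements of `A` are pushed towards `x₀`. -/
noncomputable def compress (A : Finset (ι × (Fin (n + 1) → ℕ))) : Finset (ι × (Fin (n + 1) → ℕ)) :=
  A.image (compressMap s A)

variable {s} in
theorem mem_lineFinset {A : Finset (ι × (Fin (n + 1) → ℕ))} {p : ι} {m : Fin (n + 1) → ℕ} {a : ℕ} :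
    a ∈ lineFinset s A p m ↔ a ≤ m 0 + m s.succ ∧ (p, linePoint s m a) ∈ A := by
  simp [lineFinset]

theorem lineFinset_linePoint (A : Finset (ι × (Fin (n + 1) → ℕ))) (p : ι) (m : Fin (n + 1) → ℕ)
    {a : ℕ} (ha : a ≤ m 0 + m s.succ) :
    lineFinset s A p (linePoint s m a) = lineFinset s A p m := by
  ext b
  rw [mem_lineFinset, mem_lineFinset, linePoint_linePoint s m ha]
  simp [ha]

theorem lineRank_le (A : Finset (ι × (Fin (n + 1) → ℕ))) (x : ι × (Fin (n + 1) → ℕ)) :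
    lineRank s A x ≤ x.2 s.succ := by
  refine (Finset.card_le_card (t := Finset.range (x.2 s.succ)) fun a ha => ?_).trans (by simp)
  simpa using (Finset.mem_filter.1 ha).2

theorem lineRank_lt (A : Finset (ι × (Fin (n + 1) → ℕ))) (x : ι × (Fin (n + 1) → ℕ)) {b : ℕ}
    (hb : b < x.2 s.succ) (hbA : b ∉ lineFinset s A x.1 x.2) :
    lineRank s A x < x.2 s.succ := by
  refine (Finset.card_lt_card (t := Finset.range (x.2 s.succ)) ?_).trans_eq (by simp)
  refine (Finset.ssubset_iff_of_subset fun a ha => ?_).2 ⟨b, by simpa using hb, ?_⟩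
  · simpa using (Finset.mem_filter.1 ha).2
  · exact fun h => hbA (Finset.mem_filter.1 h).1

theorem self_mem_lineFinset {A : Finset (ι × (Fin (n + 1) → ℕ))} {x : ι × (Fin (n + 1) → ℕ)}
    (hx : x ∈ A) : x.2 s.succ ∈ lineFinset s A x.1 x.2 :=
  mem_lineFinset.2 ⟨by omega, by simpa using hx⟩

theorem card_filter_lt_strictMonoOn (F : Finset ℕ) :
    StrictMonoOn (fun a => (F.filter fun b => b < a).card) F := by
  intro a ha b _ hab
  refine Finset.card_lt_card ((Finset.ssubset_iff_of_subset fun c hc => ?_).2 ⟨a, ?_, ?_⟩)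
  · simp only [Finset.mem_filter] at hc ⊢
    exact ⟨hc.1, hc.2.trans hab⟩
  · simpa [hab] using ha
  · simp

theorem exists_card_filter_lt_eq (F : Finset ℕ) {c : ℕ} (hc : c < F.card) :
    ∃ a ∈ F, (F.filter fun b => b < a).card = c := by
  have h : F.image (fun a => (F.filter fun b => b < a).card) = Finset.range F.card := by
    refine Finset.eq_of_subset_of_card_le ?_ ?_
    · intro c hc
      obtain ⟨a, ha, rfl⟩ := Finset.mem_image.1 hc
      refine Finset.mem_range.2 (Finset.card_lt_card ?_)
      exact (Finset.ssubset_iff_of_subset (Finset.filter_subset _ _)).2 ⟨a, ha, by simp⟩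
    · rw [Finset.card_image_of_injOn (card_filter_lt_strictMonoOn F).injOn, Finset.card_range]
  have := Finset.mem_range.2 hc
  rw [← h] at this
  simpa using this

theorem compressMap_injOn (A : Finset (ι × (Fin (n + 1) → ℕ))) :
    Set.InjOn (compressMap s A) A := by
  rintro ⟨p, m⟩ hx ⟨q, m'⟩ hy h
  simp only [compressMap, Prod.mk.injEq] at h
  obtain ⟨rfl, h⟩ := h
  have hr := lineRank_le s A (p, m)
  have hr' := lineRank_le s A (p, m')
  have hL : linePoint s m = linePoint s m' := by
    rw [← linePoint_linePoint s m (a := lineRank s A (p, m)) (by simp only at hr; omega), h,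
      linePoint_linePoint s m' (by simp only at hr'; omega)]
  have hF : lineFinset s A p m = lineFinset s A p m' := by
    rw [← lineFinset_linePoint s A p m (a := lineRank s A (p, m)) (by simp only at hr; omega), h,
      lineFinset_linePoint s A p m' (by simp only at hr'; omega)]
  have hrr : lineRank s A (p, m) = lineRank s A (p, m') := by
    simpa using congrFun h s.succ
  have hs : m s.succ = m' s.succ := by
    refine (card_filter_lt_strictMonoOn (lineFinset s A p m)).injOn
      (self_mem_lineFinset s hx) ?_ ?_
    · rw [hF]; exact self_mem_lineFinset s hy
    · simp only [lineRank] at hrr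
      rw [← hF] at hrr
      exact hrr
  rw [← linePoint_eq s m, ← linePoint_eq s m', hL, hs]

theorem card_compress (A : Finset (ι × (Fin (n + 1) → ℕ))) : (compress s A).card = A.card := by
  classical exact Finset.card_image_of_injOn (compressMap_injOn s A)

variable {s} in
theorem mem_compress {A : Finset (ι × (Fin (n + 1) → ℕ))} {p : ι} {m : Fin (n + 1) → ℕ} :
    (p, m) ∈ compress s A ↔ m s.succ < (lineFinset s A p m).card := by
  classical
  constructor
  · intro h
    obtain ⟨x, hx, hxm⟩ := Finset.mem_image.1 h
    have hr := lineRank_le s A x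
    simp only [compressMap, Prod.mk.injEq] at hxm
    obtain ⟨rfl, rfl⟩ := hxm
    rw [lineFinset_linePoint s A _ _ (by omega), linePoint_self]
    refine Finset.card_lt_card ((Finset.ssubset_iff_of_subset (Finset.filter_subset _ _)).2
      ⟨x.2 s.succ, self_mem_lineFinset s hx, by simp⟩)
  · intro h
    obtain ⟨a, ha, hac⟩ := exists_card_filter_lt_eq _ h
    rw [mem_lineFinset] at ha
    refine Finset.mem_image.2 ⟨_, ha.2, ?_⟩
    have : lineRank s A (p, linePoint s m a) = m s.succ := by
      simp only [lineRank, lineFinset_linePoint s A p m ha.1, linePoint_self, hac]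
    simp only [compressMap, this, linePoint_linePoint s m ha.1, linePoint_eq]

theorem sum_compressMap (A : Finset (ι × (Fin (n + 1) → ℕ))) (x : ι × (Fin (n + 1) → ℕ)) :
    ∑ j, (compressMap s A x).2 j = ∑ j, x.2 j := by
  have hr := lineRank_le s A x
  exact sum_linePoint s x.2 (by omega)

/-- Shadows on a line: if `F` is the set of exponents `a` of monomials `x ^ a y ^ (e + 1 - a)`, then
`G` contains those of their quotients by `x` or `y`. Unless `F` is the whole line, `G` has at least
as many elements as `F`. -/
theorem lt_card_of_shadow_line {F G : Finset ℕ} {e c : ℕ} (hF : ∀ a ∈ F, a ≤ e + 1)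
    (h1 : ∀ a ∈ F, a ≤ e → a ∈ G) (h2 : ∀ a, a + 1 ∈ F → a ∈ G) (hce : c ≤ e)
    (hc : c < F.card) : c < G.card := by
  by_cases hfull : ∀ g ≤ e + 1, g ∈ F
  · have : Finset.range (e + 1) ⊆ G := fun a ha => by
      have := Finset.mem_range.1 ha
      exact h1 a (hfull a (by omega)) (by omega)
    have := Finset.card_le_card this
    rw [Finset.card_range] at this
    omega
  · push Not at hfull
    obtain ⟨g, hg, hgF⟩ := hfull
    -- elements below the gap `g` are divided by one variable, those above it by the other
    refine hc.trans_le (Finset.card_le_card_of_injOn (fun a => if a < g then a else a - 1) ?_ ?_)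
    · intro a ha
      have := hF a ha
      have hag : a ≠ g := fun h => hgF (h ▸ ha)
      simp only
      split_ifs with h
      · exact h1 a ha (by omega)
      · refine h2 _ ?_
        rwa [Nat.sub_add_cancel (by omega)]
    · intro a ha b hb hab
      have hag : a ≠ g := fun h => hgF (h ▸ ha)
      have hbg : b ≠ g := fun h => hgF (h ▸ hb)
      simp only at hab
      split_ifs at hab <;> omega

theorem linePoint_add_single_of_ne (m : Fin (n + 1) → ℕ) (a : ℕ) {j : Fin (n + 1)} (h0 : j ≠ 0)
    (hs : j ≠ s.succ) :
    linePoint s (m + Pi.single j 1 : Fin (n + 1) → ℕ) a = linePoint s m a + Pi.single j 1 := by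
  ext i
  by_cases hi0 : i = 0
  · subst hi0; simp [h0.symm, hs.symm]
  by_cases his : i = s.succ
  · subst his; simp [hs.symm]
  simp [linePoint_of_ne s _ _ hi0 his]

theorem linePoint_eq_add_single_zero (m m' : Fin (n + 1) → ℕ) (a : ℕ)
    (he : m' 0 + m' s.succ = m 0 + m s.succ + 1)
    (hm : ∀ j, j ≠ 0 → j ≠ s.succ → m' j = m j) (ha : a ≤ m 0 + m s.succ) :
    linePoint s m' a = linePoint s m a + Pi.single 0 1 := by
  ext i
  by_cases hi0 : i = 0
  · subst hi0; simp [he]; omega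
  by_cases his : i = s.succ
  · subst his; simp [Fin.succ_ne_zero]
  simp [linePoint_of_ne s _ _ hi0 his, hm i hi0 his, hi0]

theorem linePoint_succ_eq_add_single (m m' : Fin (n + 1) → ℕ) (a : ℕ)
    (he : m' 0 + m' s.succ = m 0 + m s.succ + 1)
    (hm : ∀ j, j ≠ 0 → j ≠ s.succ → m' j = m j) :
    linePoint s m' (a + 1) = linePoint s m a + Pi.single s.succ 1 := by
  ext i
  by_cases hi0 : i = 0
  · subst hi0; simp [he, (Fin.succ_ne_zero s).symm]
  by_cases his : i = s.succ
  · subst his; simp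
  simp [linePoint_of_ne s _ _ hi0 his, hm i hi0 his, his]

theorem ShadowSubset.compress {A B : Finset (ι × (Fin (n + 1) → ℕ))} (h : ShadowSubset A B) :
    ShadowSubset (compress s A) (compress s B) := by
  intro p m j hj
  rw [mem_compress] at hj ⊢
  by_cases hne : j ≠ 0 ∧ j ≠ s.succ
  · have e0 : (m + Pi.single j 1 : Fin (n + 1) → ℕ) 0 = m 0 := by simp [hne.1.symm]
    have es : (m + Pi.single j 1 : Fin (n + 1) → ℕ) s.succ = m s.succ := by simp [hne.2.symm]
    rw [es] at hj
    refine hj.trans_le (Finset.card_le_card fun a ha => ?_)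
    rw [mem_lineFinset, e0, es, linePoint_add_single_of_ne s m a hne.1 hne.2] at ha
    exact mem_lineFinset.2 ⟨ha.1, h _ _ _ ha.2⟩
  · have hj' : j = 0 ∨ j = s.succ := by tauto
    have he : (m + Pi.single j 1 : Fin (n + 1) → ℕ) 0 +
        (m + Pi.single j 1 : Fin (n + 1) → ℕ) s.succ = m 0 + m s.succ + 1 := by
      rcases hj' with rfl | rfl
      · simp [Fin.succ_ne_zero]; omega
      · simp [(Fin.succ_ne_zero s).symm]; omega
    have hm : ∀ i, i ≠ 0 → i ≠ s.succ → (m + Pi.single j 1 : Fin (n + 1) → ℕ) i = m i := by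
      intro i hi0 his
      have : i ≠ j := by rcases hj' with rfl | rfl <;> assumption
      simp [this]
    refine lt_card_of_shadow_line (e := m 0 + m s.succ)
      (F := lineFinset s A p (m + Pi.single j 1)) ?_ ?_ ?_ (by omega)
      (lt_of_le_of_lt (by simp) hj)
    · intro a ha
      rw [mem_lineFinset, he] at ha
      exact ha.1
    · intro a ha hae
      rw [mem_lineFinset, linePoint_eq_add_single_zero s m _ a he hm hae] at ha
      exact mem_lineFinset.2 ⟨hae, h _ _ _ ha.2⟩
    · intro a ha
      rw [mem_lineFinset, he, linePoint_succ_eq_add_single s m _ a he hm] at ha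
      exact mem_lineFinset.2 ⟨by omega, h _ _ _ ha.2⟩

theorem sum_compress_lt {B : Finset (ι × (Fin (n + 1) → ℕ))} {p : ι} {m : Fin (n + 1) → ℕ}
    (h : (p, m + Pi.single s.succ 1) ∈ B) (h' : (p, m + Pi.single 0 1) ∉ B) :
    ∑ x ∈ compress s B, ∑ i : Fin n, x.2 i.succ < ∑ x ∈ B, ∑ i : Fin n, x.2 i.succ := by
  classical
  have hle : ∀ x : ι × (Fin (n + 1) → ℕ), ∀ i : Fin n,
      (compressMap s B x).2 i.succ ≤ x.2 i.succ := by
    intro x i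
    by_cases his : i = s
    · subst his; simpa [compressMap] using lineRank_le i B x
    · simp only [compressMap]
      rw [linePoint_of_ne s _ _ (Fin.succ_ne_zero i) (by simpa using his)]
  rw [Gotzmann.compress, Finset.sum_image (compressMap_injOn s B)]
  refine Finset.sum_lt_sum (fun x _ => Finset.sum_le_sum fun i _ => hle x i) ⟨_, h, ?_⟩
  refine Finset.sum_lt_sum (fun i _ => hle _ i) ⟨s, Finset.mem_univ _, ?_⟩
  have he : (m + Pi.single s.succ 1 : Fin (n + 1) → ℕ) 0 +
      (m + Pi.single s.succ 1 : Fin (n + 1) → ℕ) s.succ =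
      m 0 + m s.succ + 1 := by
    simp [(Fin.succ_ne_zero s).symm]; omega
  simp only [compressMap, linePoint_self]
  refine lineRank_lt s B _ (b := m s.succ) (by simp) fun hb => h' ?_
  rw [mem_lineFinset, linePoint_eq_add_single_zero s m _ _ he ?_ (by omega), linePoint_eq] at hb
  · exact hb.2
  · intro j _ hj
    simp [hj]

end Compression

/-- Compression replaces a set and its shadow by sets of the same size of which the second is
stable. It terminates since it lowers the exponents of the variables other than `x₀`. -/
theorem exists_isStable {ι : Type*} {n : ℕ} (d e : ℕ) (A B : Finset (ι × (Fin (n + 1) → ℕ)))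
    (h : ShadowSubset A B) (hA : ∀ x ∈ A, d ≤ ∑ j, x.2 j) (hB : ∀ x ∈ B, e ≤ ∑ j, x.2 j) :
    ∃ A' B' : Finset (ι × (Fin (n + 1) → ℕ)), ShadowSubset A' B' ∧ IsStable B' ∧
      (∀ x ∈ A', d ≤ ∑ j, x.2 j) ∧ (∀ x ∈ B', e ≤ ∑ j, x.2 j) ∧
      A'.card = A.card ∧ B'.card = B.card := by
  classical
  induction hN : ∑ x ∈ B, ∑ i : Fin n, x.2 i.succ using Nat.strong_induction_on
    generalizing A B with
  | _ N ih =>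
    by_cases hst : IsStable B
    · exact ⟨A, B, h, hst, hA, hB, rfl, rfl⟩
    · simp only [IsStable, not_forall] at hst
      obtain ⟨p, m, s, hm, hm'⟩ := hst
      have hdeg : ∀ (c : ℕ) (C : Finset (ι × (Fin (n + 1) → ℕ))), (∀ x ∈ C, c ≤ ∑ j, x.2 j) →
          ∀ x ∈ compress s C, c ≤ ∑ j, x.2 j := by
        intro c C hC x hx
        obtain ⟨y, hy, rfl⟩ := Finset.mem_image.1 hx
        rw [sum_compressMap]
        exact hC y hy
      obtain ⟨A', B', h1, h2, h3, h4, h5, h6⟩ := ih _ (hN ▸ sum_compress_lt s hm hm')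
        (compress s A) (compress s B) (h.compress s) (hdeg d A hA) (hdeg e B hB) rfl
      exact ⟨A', B', h1, h2, h3, h4, h5.trans (card_compress s A), h6.trans (card_compress s B)⟩

/-! ### Growth of coloured order ideals of monomials -/

open Classical in
/-- The coloured monomials in the variables other than `x₀` whose product with `x₀ ^ j` lies in
`B`. -/
noncomputable def slice {ι : Type*} {n : ℕ} (j : ℕ) (B : Finset (ι × (Fin (n + 1) → ℕ))) :
    Finset (ι × (Fin n → ℕ)) :=
  (B.filter fun x => x.2 0 = j).image fun x => (x.1, Fin.tail x.2)

section Slice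

variable {ι : Type*} {n : ℕ}

theorem mem_slice {j : ℕ} {B : Finset (ι × (Fin (n + 1) → ℕ))} {p : ι} {m : Fin n → ℕ} :
    (p, m) ∈ slice j B ↔ (p, (Fin.cons j m : Fin (n + 1) → ℕ)) ∈ B := by
  classical
  simp only [slice, Finset.mem_image, Finset.mem_filter, Prod.mk.injEq]
  constructor
  · rintro ⟨⟨q, m'⟩, ⟨h1, rfl⟩, rfl, rfl⟩
    simpa using h1
  · intro h
    exact ⟨_, ⟨h, by simp⟩, rfl, by simp⟩

theorem card_slice (j : ℕ) (B : Finset (ι × (Fin (n + 1) → ℕ))) :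
    (slice j B).card = (B.filter fun x => x.2 0 = j).card := by
  classical
  refine Finset.card_image_of_injOn ?_
  rintro ⟨p, m⟩ hm ⟨q, m'⟩ hm' h
  simp only [Finset.coe_filter, Set.mem_ofPred_eq, Prod.mk.injEq] at hm hm' h
  rw [Prod.mk.injEq, ← Fin.cons_self_tail m, ← Fin.cons_self_tail m', hm.2, hm'.2, h.2]
  exact ⟨h.1, rfl⟩

theorem le_sum_of_mem_slice {j d : ℕ} {B : Finset (ι × (Fin (n + 1) → ℕ))}
    (hB : ∀ x ∈ B, d ≤ ∑ i, x.2 i) : ∀ x ∈ slice j B, d - j ≤ ∑ i, x.2 i := by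
  rintro ⟨p, m⟩ hx
  have := hB _ (mem_slice.1 hx)
  simp only [Fin.sum_univ_succ, Fin.cons_zero, Fin.cons_succ] at this
  simp only
  omega

theorem cons_add_single_succ (j : ℕ) (m : Fin n → ℕ) (i : Fin n) :
    (Fin.cons j (m + Pi.single i 1) : Fin (n + 1) → ℕ) =
      (Fin.cons j m : Fin (n + 1) → ℕ) + Pi.single i.succ 1 := by
  ext k
  refine Fin.cases ?_ (fun k => ?_) k
  · simp [(Fin.succ_ne_zero i).symm]
  · simp [Pi.single_apply]

theorem cons_succ_eq_add_single_zero (j : ℕ) (m : Fin n → ℕ) :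
    (Fin.cons (j + 1) m : Fin (n + 1) → ℕ) =
      (Fin.cons j m : Fin (n + 1) → ℕ) + Pi.single 0 1 := by
  ext k
  refine Fin.cases ?_ (fun k => ?_) k
  · simp
  · simp [Fin.succ_ne_zero]

theorem ShadowSubset.slice {A B : Finset (ι × (Fin (n + 1) → ℕ))} (h : ShadowSubset A B) (j : ℕ) :
    ShadowSubset (slice j A) (slice j B) := by
  intro p m i hm
  rw [mem_slice] at hm ⊢
  exact h p _ i.succ (by rwa [← cons_add_single_succ])

theorem IsStable.shadowSubset_slice {B : Finset (ι × (Fin (n + 1) → ℕ))} (h : IsStable B) (j : ℕ) :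
    ShadowSubset (Gotzmann.slice j B) (Gotzmann.slice (j + 1) B) := by
  intro p m i hm
  rw [mem_slice] at hm ⊢
  rw [cons_succ_eq_add_single_zero]
  exact h p _ i (by rwa [← cons_add_single_succ])

theorem sum_card_slice_le (d : ℕ) (B : Finset (ι × (Fin (n + 1) → ℕ))) :
    ∑ j ∈ Finset.range (d + 1), (slice (d - j) B).card ≤ B.card := by
  classical
  rw [← Finset.sum_range_reflect]
  simp only [card_slice]
  rw [Finset.sum_congr (g := fun j => (B.filter fun x => x.2 0 = j).card) rfl fun j hj => by
    have := Finset.mem_range.1 hj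
    rw [show d - (d + 1 - 1 - j) = j by omega]]
  rw [← Finset.card_biUnion]
  · exact Finset.card_le_card (Finset.biUnion_subset.2 fun j _ => Finset.filter_subset _ _)
  · intro i _ j _ hij
    exact Finset.disjoint_filter.2 fun x _ h1 h2 => hij (h1.symm.trans h2)

/-- The elements of `A` divisible by `x₀` inject into `B`; the others form a slice. -/
theorem card_le_card_slice_zero_add {A B : Finset (ι × (Fin (n + 1) → ℕ))}
    (h : ShadowSubset A B) : A.card ≤ (Gotzmann.slice 0 A).card + B.card := by
  classical
  rw [← Finset.card_filter_add_card_filter_not (s := A) (fun x => x.2 0 = 0), card_slice]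
  refine Nat.add_le_add_left (Finset.card_le_card_of_injOn
    (fun x => (x.1, (Fin.cons (x.2 0 - 1) (Fin.tail x.2) : Fin (n + 1) → ℕ))) ?_ ?_) _
  · rintro ⟨p, m⟩ hm
    simp only [Finset.coe_filter, Set.mem_ofPred_eq] at hm
    refine h p _ 0 ?_
    rw [← cons_succ_eq_add_single_zero, Nat.sub_add_cancel (Nat.pos_of_ne_zero hm.2),
      Fin.cons_self_tail]
    exact hm.1
  · rintro ⟨p, m⟩ hm ⟨q, m'⟩ hm' he
    simp only [Finset.coe_filter, Set.mem_ofPred_eq, Prod.mk.injEq, Fin.cons_inj] at hm hm' he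
    rw [Prod.mk.injEq, ← Fin.cons_self_tail m, ← Fin.cons_self_tail m', he.2.2,
      show m 0 = m' 0 by have := hm.2; have := hm'.2; have := he.2.1; omega]
    exact ⟨he.1, rfl⟩

end Slice

/-- **Macaulay's growth bound** for coloured monomials. The colours may be given any degrees `≤ 0`,
so that the exponent vectors in degree `d` have at least the degree `d`. -/
theorem card_le_macaulaySum_succ {ι : Type*} (n : ℕ) : ∀ (d : ℕ) (l : List ℕ)
    (A B : Finset (ι × (Fin n → ℕ))), l.Pairwise (fun x y => x ≥ y) → l.length ≤ d →
    ShadowSubset A B → (∀ x ∈ A, d + 1 ≤ ∑ i, x.2 i) → (∀ x ∈ B, d ≤ ∑ i, x.2 i) →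
    B.card ≤ macaulaySum d l → A.card ≤ macaulaySum (d + 1) l := by
  induction n with
  | zero =>
    intro d l A B _ _ _ hA _ _
    have : A = ∅ := Finset.eq_empty_of_forall_notMem fun x hx => by simpa using hA x hx
    simp [this]
  | succ n ih =>
    intro d l A B hl hld hAB hA hB hcard
    obtain ⟨A', B', hAB', hst, hA', hB', hcA, hcB⟩ := exists_isStable (d + 1) d A B hAB hA hB
    rw [← hcA]
    rw [← hcB] at hcard
    obtain ⟨b, z, hb, rfl⟩ := exists_eq_map_succ_append_replicate_zero l hl
    simp only [List.length_append, List.length_map, List.length_replicate] at hld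
    -- the bound for hyperplane sections: otherwise all the slices of `B'` are large, by the growth
    -- bound in the remaining variables
    have green : (slice 0 B').card ≤ macaulaySum d b := by
      by_contra! hlt
      have key : ∀ i ≤ d,
          macaulaySum (d - i) (b.take (d - i)) < (slice (d - (d - i)) B').card := by
        intro i
        induction i with
        | zero => intro _; simpa [List.take_of_length_le (show b.length ≤ d by omega)] using hlt
        | succ i ihi =>
          intro hi
          have h1 := ihi (by omega)
          obtain ⟨j, hj⟩ : ∃ j, d - i = j + 1 := ⟨d - i - 1, by omega⟩
          have hj' : d - (i + 1) = j := by omega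
          rw [hj'] at *
          rw [hj] at h1
          by_contra! hle
          have h2 := ih j (b.take j) (slice (d - (j + 1)) B') (slice (d - j) B')
            (hb.sublist (List.take_sublist _ _)) (by simp) (by
              have := hst.shadowSubset_slice (d - (j + 1))
              rwa [show d - (j + 1) + 1 = d - j by omega] at this)
            (fun x hx => by have := le_sum_of_mem_slice hB' x hx; omega)
            (fun x hx => by have := le_sum_of_mem_slice hB' x hx; omega) hle
          have h3 := macaulaySum_take_le (j + 1) j (b.take (j + 1))
          rw [List.take_take, min_eq_left (by omega)] at h3
          omega
      have h4 := macaulaySum_lt_sum d z b hld (fun j => (slice (d - j) B').card) (fun j hj => by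
        have := key (d - j) (by omega)
        rwa [show d - (d - j) = j by omega] at this)
      have h5 := sum_card_slice_le d B'
      omega
    have h6 := ih d b (slice 0 A') (slice 0 B') hb (by omega) (hAB'.slice 0)
      (le_sum_of_mem_slice hA') (le_sum_of_mem_slice hB') green
    have h7 := card_le_card_slice_zero_add hAB'
    rw [macaulaySum_succ_eq d z b hld]
    omega

/-! ### Functions with Macaulay growth -/

theorem macaulaySum_replicate_add_one (d c : ℕ) :
    macaulaySum d (List.replicate d c) + 1 = (d + (c + 1)).choose (c + 1) := by
  induction d with
  | zero => simp
  | succ d ih =>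
    rw [List.replicate_succ, macaulaySum_succ_cons, add_assoc, ih,
      show d + 1 + (c + 1) = (d + (c + 1)) + 1 by ring, Nat.choose_succ_succ,
      show d + 1 + c = d + (c + 1) by ring]

/-- A function subject to Macaulay's growth bound is eventually equal to the binomial sum of some
weakly decreasing sequence. The sequence is a minimal one, in a well-founded order, among those
whose binomial sum is an upper bound: if an upper bound is not sharp in some degree `d`, its last
entry can be dropped or replaced by many smaller ones, for a sequence of length `d`. -/
theorem exists_eventually_eq_macaulaySum (H : ℕ → ℕ)
    (hH : ∀ (d : ℕ) (l : List ℕ), l.Pairwise (fun x y => x ≥ y) → l.length ≤ d →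
      H d ≤ macaulaySum d l → H (d + 1) ≤ macaulaySum (d + 1) l) :
    ∃ l : List ℕ, l.Pairwise (fun x y => x ≥ y) ∧
      ∃ d₀, l.length ≤ d₀ ∧ ∀ d, d₀ ≤ d → H d = macaulaySum d l := by
  -- `[H 1]` is an upper bound in degree `1`, since `(1 + a choose a) = a + 1`
  let S : Set (List ℕ) := {l | l.Pairwise (fun x y => x ≥ y) ∧
    ∃ d, l.length ≤ d ∧ H d ≤ macaulaySum d l}
  have hne : S.Nonempty := ⟨[H 1], by simp, 1, by simp, by simp [add_comm 1]⟩
  have wf : WellFounded fun l m : List ℕ =>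
      Multiset.IsDershowitzMannaLT (l : Multiset ℕ) (m : Multiset ℕ) :=
    InvImage.wf _ Multiset.wellFounded_isDershowitzMannaLT
  obtain ⟨l, ⟨hl, d₀, hd₀, hHd₀⟩, hmin⟩ := wf.has_min S hne
  refine ⟨l, hl, d₀, hd₀, fun d hd => ?_⟩
  have hle : H d ≤ macaulaySum d l := by
    induction d, hd using Nat.le_induction with
    | base => exact hHd₀
    | succ d hd ih => exact hH d l hl (hd₀.trans hd) ih
  by_contra hne'
  have hlt := lt_of_le_of_ne hle hne'
  rcases List.eq_nil_or_concat l with rfl | ⟨l, a, rfl⟩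
  · simp at hlt
  rw [List.concat_eq_append] at *
  simp only [List.length_append, List.length_singleton] at hd₀
  rw [List.pairwise_append] at hl
  obtain ⟨e, he⟩ : ∃ e, d - l.length = e + 1 := ⟨d - l.length - 1, by omega⟩
  rw [macaulaySum_append _ _ _ (by omega), he] at hlt
  cases a with
  | zero =>
    refine hmin l ⟨hl.1, d, by omega, ?_⟩ ⟨l, 0, {0},
      Multiset.singleton_ne_zero _, by simp, by simp [← Multiset.coe_add], by simp⟩
    simp at hlt
    omega
  | succ c =>
    refine hmin (l ++ List.replicate (d - l.length) c) ⟨?_, d, by simp; omega, ?_⟩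
      ⟨l, Multiset.replicate (d - l.length) c, {c + 1},
        Multiset.singleton_ne_zero _, ?_, ?_, ?_⟩
    · rw [List.pairwise_append]
      refine ⟨hl.1, by simp [List.pairwise_replicate], fun x hx y hy => ?_⟩
      have h1 := hl.2.2 x hx (c + 1) (by simp)
      have h2 := List.eq_of_mem_replicate hy
      omega
    · rw [macaulaySum_append _ _ _ (by omega), he]
      have := macaulaySum_replicate_add_one (e + 1) c
      simp only [macaulaySum_succ_cons, macaulaySum_nil] at hlt
      omega
    · rw [← Multiset.coe_add, Multiset.coe_replicate]
    · rw [← Multiset.coe_add, Multiset.coe_singleton]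
    · intro y hy
      rw [Multiset.eq_of_mem_replicate hy]
      exact ⟨c + 1, by simp, by simp⟩

theorem macaulaySum_le_length_mul (d b : ℕ) (l : List ℕ) (hl : ∀ x ∈ l, x ≤ b) :
    macaulaySum d l ≤ l.length * (d + b).choose b := by
  induction l generalizing d with
  | nil => simp
  | cons a l ih =>
    have hab : a ≤ b := hl a (by simp)
    have hmono : (d + a).choose a ≤ (d + b).choose b := by
      rw [← Nat.choose_symm_add, ← Nat.choose_symm_add]
      exact Nat.choose_le_choose d (by omega)
    cases d with
    | zero => simp
    | succ d =>
      have h1 := ih d fun x hx => hl x (by simp [hx])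
      have h2 : (d + b).choose b ≤ (d + 1 + b).choose b := Nat.choose_le_choose b (by omega)
      have h3 := Nat.mul_le_mul_left l.length h2
      rw [macaulaySum_succ_cons, List.length_cons, add_mul, one_mul]
      omega

theorem choose_le_macaulaySum_cons (d a : ℕ) (l : List ℕ) :
    (d + a).choose a ≤ macaulaySum d (a :: l) := by
  cases d <;> simp

theorem macaulaySum_lt_macaulaySum_cons {a d : ℕ} {l m : List ℕ} (hl : ∀ x ∈ l, x < a)
    (hd : l.length * a ≤ d) : macaulaySum d l < macaulaySum d (a :: m) := by
  refine lt_of_lt_of_le ?_ (choose_le_macaulaySum_cons d a m)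
  cases a with
  | zero =>
    have : l = [] := List.eq_nil_iff_forall_not_mem.2 fun x hx => Nat.not_lt_zero x (hl x hx)
    simp [this]
  | succ b =>
    have h1 := macaulaySum_le_length_mul d b l fun x hx => Nat.le_of_lt_succ (hl x hx)
    have h2 := Nat.add_one_mul_choose_eq (d + b) b
    have h3 : 0 < (d + b).choose b := Nat.choose_pos (by omega)
    rw [← add_assoc]
    refine lt_of_mul_lt_mul_right (a := b + 1) ?_ (by omega)
    rw [← h2]
    calc macaulaySum d l * (b + 1) ≤ l.length * (d + b).choose b * (b + 1) :=
          Nat.mul_le_mul_right _ h1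
      _ = l.length * (b + 1) * (d + b).choose b := by ring
      _ ≤ d * (d + b).choose b := Nat.mul_le_mul_right _ hd
      _ < (d + b + 1) * (d + b).choose b := Nat.mul_lt_mul_of_pos_right (by omega) h3

theorem eq_of_macaulaySum_eq {l m : List ℕ} (hl : l.Pairwise (fun x y => x ≥ y))
    (hm : m.Pairwise (fun x y => x ≥ y)) {d₀ : ℕ}
    (h : ∀ d, d₀ ≤ d → macaulaySum d l = macaulaySum d m) : l = m := by
  have aux : ∀ {a d : ℕ} {l m : List ℕ}, (∀ x ∈ l, x < a) → d₀ ≤ d → l.length * a ≤ d →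
      macaulaySum d l ≠ macaulaySum d (a :: m) := fun hl _ hd =>
    (macaulaySum_lt_macaulaySum_cons hl hd).ne
  induction l generalizing m d₀ with
  | nil => cases m with
    | nil => rfl
    | cons b m => exact absurd (h d₀ le_rfl) (aux (by simp) le_rfl (by simp))
  | cons a l ih => cases m with
    | nil => exact absurd (h d₀ le_rfl).symm (aux (by simp) le_rfl (by simp))
    | cons b m =>
      have hl' : ∀ x ∈ a :: l, x ≤ a := by
        rw [List.pairwise_cons] at hl
        simpa using hl.1
      have hm' : ∀ x ∈ b :: m, x ≤ b := by
        rw [List.pairwise_cons] at hm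
        simpa using hm.1
      rcases lt_trichotomy a b with hab | rfl | hab
      · exact absurd (h _ (le_max_left d₀ ((a :: l).length * b))) (aux
          (fun x hx => (hl' x hx).trans_lt hab) (le_max_left _ _) (le_max_right _ _))
      · rw [ih (List.pairwise_cons.1 hl).2 (List.pairwise_cons.1 hm).2 (d₀ := d₀) fun d hd => ?_]
        · intro a d l m hl hd hd'
          exact (macaulaySum_lt_macaulaySum_cons hl hd').ne
        · have := h (d + 1) (by omega)
          simpa using this
      · exact absurd (h _ (le_max_left d₀ ((b :: m).length * a))).symm (aux
          (fun x hx => (hm' x hx).trans_lt hab) (le_max_left _ _) (le_max_right _ _))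

/-! ### Gotzmann representations -/

theorem sum_binomialTerm_eval_eq (l : List ℕ) : ∀ i d : ℕ, i + l.length ≤ d →
    ∑ j : Fin l.length, (binomialTerm (l.get j) (i + j : ℕ)).eval (d : ℚ) =
      (macaulaySum (d - i) l : ℚ) := by
  induction l with
  | nil => intro i d _; simp
  | cons a l ih =>
    intro i d hd
    simp only [List.length_cons] at hd
    obtain ⟨e, he⟩ : ∃ e, d - i = e + 1 := ⟨d - i - 1, by omega⟩
    have h1 := ih (i + 1) d (by omega)
    rw [show d - (i + 1) = e by omega] at h1
    rw [he, macaulaySum_succ_cons, Nat.cast_add, ← h1]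
    refine (Fin.sum_univ_succ (n := l.length) _).trans ?_
    congr 1
    · simp only [List.get_cons_zero, Fin.val_zero, add_zero]
      rw [binomialTerm_eval _ _ _ (by omega), show d + a - i = e + 1 + a by omega, he,
        Nat.choose_symm_add]
    · refine Finset.sum_congr rfl fun j _ => ?_
      rw [Fin.val_succ, show i + ((j : ℕ) + 1) = i + 1 + j by ring]
      rfl

theorem eval_sum_binomialTerm (l : List ℕ) {d : ℕ} (hd : l.length ≤ d) :
    (∑ i : Fin l.length, binomialTerm (l.get i) (i : ℕ)).eval (d : ℚ) = macaulaySum d l := by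
  have := sum_binomialTerm_eval_eq l 0 d (by simpa using hd)
  simp only [zero_add, Nat.sub_zero] at this
  rw [Polynomial.eval_finsetSum, this]

theorem IsGotzmannRepresentation.eval {P : Polynomial ℚ} {a : List ℕ}
    (h : IsGotzmannRepresentation P a) {d : ℕ} (hd : a.length ≤ d) :
    P.eval (d : ℚ) = macaulaySum d a := by
  rw [h.2, eval_sum_binomialTerm a hd]

theorem IsGotzmannRepresentation.unique {P : Polynomial ℚ} {a b : List ℕ}
    (ha : IsGotzmannRepresentation P a) (hb : IsGotzmannRepresentation P b) : a = b := by
  refine eq_of_macaulaySum_eq ha.1 hb.1 (d₀ := max a.length b.length) fun d hd => ?_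
  have h1 := ha.eval (d := d) (by omega)
  have h2 := hb.eval (d := d) (by omega)
  exact_mod_cast h1.symm.trans h2

theorem not_isGotzmannRepresentation_X (a : List ℕ) :
    ¬ IsGotzmannRepresentation Polynomial.X a := by
  intro h
  have hX : ∀ d : ℕ, a.length ≤ d → d = macaulaySum d a := fun d hd => by
    have := h.eval hd
    rw [Polynomial.eval_X] at this
    exact_mod_cast this
  have h1 := hX (a.length + 1) (by omega)
  cases a with
  | nil => simp at h1
  | cons c l => cases c with
    | zero =>
      -- a sequence of zeros represents a constant
      have := macaulaySum_le_length_mul ((0 :: l).length + 1) 0 (0 :: l) (by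
        simpa using (List.pairwise_cons.1 h.1).1)
      simp only [Nat.choose_zero_right, mul_one] at this
      omega
    | succ c =>
      have h2 := choose_le_macaulaySum_cons (((c + 1) :: l).length + 1) (c + 1) l
      have h3 : (((c + 1) :: l).length + 1 + 1).choose 1 ≤
          (((c + 1) :: l).length + 1 + (c + 1)).choose (c + 1) := by
        rw [← Nat.choose_symm_add, ← Nat.choose_symm_add]
        exact Nat.choose_le_choose _ (by omega)
      rw [Nat.choose_one_right] at h3
      omega

/-! ### Standard monomials -/

open Classical in
/-- Discarding the vectors in the span of the preceding ones leaves a basis of the span. The family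
is ordered by means of an injective key `κ`. -/
theorem finrank_span_image_eq_card {K V I J : Type*} [DivisionRing K] [AddCommGroup V]
    [Module K V] [LinearOrder J] (v : I → V) (κ : I → J) (hκ : Function.Injective κ)
    (s : Finset I) :
    Module.finrank K (Submodule.span K (v '' s)) =
      (s.filter fun i => v i ∉ Submodule.span K (v '' {j | j ∈ s ∧ κ j < κ i})).card := by
  induction s using Finset.induction_on_max_value κ with
  | empty => rw [Finset.coe_empty, Set.image_empty, Submodule.span_empty, finrank_bot]; simp
  | insert a s ha hmax ih =>
    have hlt : ∀ x ∈ s, κ x < κ a := fun x hx =>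
      lt_of_le_of_ne (hmax x hx) fun h => ha (hκ h ▸ hx)
    have ha' : {j | j ∈ insert a s ∧ κ j < κ a} = (s : Set I) := by
      ext j
      simp only [Finset.mem_insert, Set.mem_ofPred_eq, Finset.mem_coe]
      refine ⟨?_, fun h => ⟨Or.inr h, hlt j h⟩⟩
      rintro ⟨rfl | h, h'⟩
      · exact absurd h' (lt_irrefl _)
      · exact h
    have hs : s.filter (fun i => v i ∉ Submodule.span K
          (v '' {j | j ∈ insert a s ∧ κ j < κ i})) =
        s.filter (fun i => v i ∉ Submodule.span K (v '' {j | j ∈ s ∧ κ j < κ i})) := by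
      refine Finset.filter_congr fun i hi => ?_
      have : {j | j ∈ insert a s ∧ κ j < κ i} = {j | j ∈ s ∧ κ j < κ i} := by
        ext j
        simp only [Finset.mem_insert, Set.mem_ofPred_eq]
        refine ⟨?_, fun h => ⟨Or.inr h.1, h.2⟩⟩
        rintro ⟨rfl | h, h'⟩
        · exact absurd h' (hlt i hi).not_gt
        · exact ⟨h, h'⟩
      rw [this]
    have hfin : FiniteDimensional K (Submodule.span K (v '' s)) :=
      FiniteDimensional.span_of_finite K (s.finite_toSet.image v)
    rw [Finset.filter_insert, ha', hs, Finset.coe_insert, Set.image_insert_eq]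
    split_ifs with h
    · rw [← ih, Submodule.span_insert_eq_span h]
    · rw [Finset.card_insert_of_notMem (by simp [ha]), ← ih]
      have hfin' : FiniteDimensional K (Submodule.span K {v a}) :=
        FiniteDimensional.span_of_finite K (Set.finite_singleton _)
      have hv : v a ≠ 0 := fun h0 => h (h0 ▸ Submodule.zero_mem _)
      have hdisj : Submodule.span K {v a} ⊓ Submodule.span K (v '' s) = ⊥ :=
        (Submodule.disjoint_span_singleton' hv).2 h |>.symm.eq_bot
      have := Submodule.finrank_sup_add_finrank_inf_eq (Submodule.span K {v a})
        (Submodule.span K (v '' s))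
      rw [hdisj, finrank_bot, finrank_span_singleton hv] at this
      rw [Submodule.span_insert]
      omega

section HilbertFunction

variable {k : Type*} [Field k] {n r : ℕ}

/-- The monomial `x ^ m e_p` of the free module, for a coloured exponent vector `(p, m)`. -/
noncomputable def freeMonomial (k : Type*) [Field k] {n r : ℕ}
    (x : Fin r × (Fin (n + 1) → ℕ)) : Fin r → MvPolynomial (Fin (n + 1)) k :=
  Pi.single x.1 (monomial (Finsupp.equivFunOnFinite.symm x.2) 1)

theorem finite_degree (f : Fin r → ℤ) (d : ℤ) :
    {x : Fin r × (Fin (n + 1) → ℕ) | ((∑ i, x.2 i : ℕ) : ℤ) = d - f x.1}.Finite := by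
  refine (Set.finite_univ.biUnion fun p (_ : p ∈ (Set.univ : Set (Fin r))) =>
    ((Finset.univ : Finset (Fin (n + 1))).piAntidiag (d - f p).toNat).finite_toSet.image
      (fun m => (p, m))).subset ?_
  rintro ⟨p, m⟩ hx
  simp only [Set.mem_ofPred_eq] at hx
  simp only [Set.mem_univ, Set.iUnion_true, Set.mem_iUnion, Set.mem_image, Finset.mem_coe,
    Finset.mem_piAntidiag]
  refine ⟨p, m, ⟨?_, by simp⟩, rfl⟩
  rw [← hx, Int.toNat_natCast]

/-- The coloured exponent vectors of the monomials of degree `d` of the free module. -/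
noncomputable def degreeFinset (n : ℕ) {r : ℕ} (f : Fin r → ℤ) (d : ℤ) :
    Finset (Fin r × (Fin (n + 1) → ℕ)) :=
  (finite_degree f d).toFinset

theorem mem_degreeFinset {f : Fin r → ℤ} {d : ℤ} {x : Fin r × (Fin (n + 1) → ℕ)} :
    x ∈ degreeFinset n f d ↔ ((∑ i, x.2 i : ℕ) : ℤ) = d - f x.1 := by
  simp [degreeFinset]

theorem weight_one_eq (c : Fin (n + 1) →₀ ℕ) :
    Finsupp.weight (fun _ : Fin (n + 1) => (1 : ℤ)) c = ((∑ i, c i : ℕ) : ℤ) := by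
  simp [Finsupp.weight_apply, Finsupp.sum_fintype]

theorem freePiece_eq_span (f : Fin r → ℤ) (d : ℤ) :
    freePiece k n f d = Submodule.span k (freeMonomial k '' (degreeFinset n f d)) := by
  apply le_antisymm
  · intro v hv
    have hv' : ∀ p, IsWeightedHomogeneous (fun _ : Fin (n + 1) => (1 : ℤ)) (v p) (d - f p) :=
      fun p => hv p (Set.mem_univ p)
    rw [← Finset.univ_sum_single v]
    refine Submodule.sum_mem _ fun p _ => ?_
    rw [(v p).as_sum, ← LinearMap.single_apply k, map_sum]
    refine Submodule.sum_mem _ fun c hc => ?_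
    have hw := hv' p (MvPolynomial.mem_support_iff.1 hc)
    rw [weight_one_eq] at hw
    have : Pi.single p (monomial c ((v p).coeff c)) =
        (v p).coeff c • freeMonomial k (p, ⇑c) := by
      rw [freeMonomial, ← Pi.single_smul, smul_monomial, smul_eq_mul, mul_one]
      simp
    rw [LinearMap.single_apply, this]
    exact Submodule.smul_mem _ _ (Submodule.subset_span ⟨_, mem_degreeFinset.2 hw, rfl⟩)
  · rw [Submodule.span_le]
    rintro _ ⟨⟨p, m⟩, hx, rfl⟩ q _
    rw [Finset.mem_coe, mem_degreeFinset] at hx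
    by_cases hpq : q = p
    · subst hpq
      rw [freeMonomial, Pi.single_eq_same]
      refine isWeightedHomogeneous_monomial _ _ _ ?_
      rw [weight_one_eq]
      exact hx
    · simp only [freeMonomial]
      rw [Pi.single_eq_of_ne hpq]
      exact Submodule.zero_mem _

theorem freeMonomial_add_single (p : Fin r) (m : Fin (n + 1) → ℕ) (i : Fin (n + 1)) :
    freeMonomial k (p, m + Pi.single i 1) =
      (X i : MvPolynomial (Fin (n + 1)) k) • freeMonomial k (p, m) := by
  rw [freeMonomial, freeMonomial, ← Pi.single_smul, smul_eq_mul, X, monomial_mul, one_mul]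
  have : Finsupp.equivFunOnFinite.symm (m + Pi.single i 1) =
      Finsupp.single i 1 + Finsupp.equivFunOnFinite.symm m := by
    ext j
    simp [Finsupp.single_apply, Pi.single_apply, add_comm, eq_comm]
  rw [this]

variable (f : Fin r → ℤ)
  (M : Submodule (MvPolynomial (Fin (n + 1)) k) (Fin r → MvPolynomial (Fin (n + 1)) k))

/-- The image of a monomial of the free module in the quotient by `M`. -/
noncomputable def quotientMonomial (x : Fin r × (Fin (n + 1) → ℕ)) :
    (Fin r → MvPolynomial (Fin (n + 1)) k) ⧸ M :=
  M.mkQ (freeMonomial k x)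

theorem quotientPiece_eq_span (d : ℤ) :
    quotientPiece f M d = Submodule.span k (quotientMonomial M '' (degreeFinset n f d)) := by
  rw [quotientPiece, freePiece_eq_span, Submodule.map_span, Set.image_image]
  rfl

/-- The position-over-term lexicographic order on the monomials of the free module. -/
def monomialKey {n r : ℕ} (x : Fin r × (Fin (n + 1) → ℕ)) : Fin r ×ₗ Lex (Fin (n + 1) → ℕ) :=
  toLex (x.1, toLex x.2)

theorem monomialKey_injective : Function.Injective (monomialKey (n := n) (r := r)) := by
  rintro ⟨p, m⟩ ⟨q, m'⟩ h
  simpa [monomialKey] using h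

theorem monomialKey_add_lt {p q : Fin r} {m m' : Fin (n + 1) → ℕ} (e : Fin (n + 1) → ℕ)
    (h : monomialKey (q, m') < monomialKey (p, m)) :
    monomialKey (q, m' + e) < monomialKey (p, m + e) := by
  simp only [monomialKey, Prod.Lex.toLex_lt_toLex, toLex_add] at h ⊢
  exact h.imp id fun h => ⟨h.1, add_lt_add_left h.2 _⟩

open Classical in
/-- The standard monomials of degree `d`: those that are not congruent modulo `M` to a linear
combination of smaller monomials of the same degree. -/
noncomputable def standardMonomials (d : ℤ) : Finset (Fin r × (Fin (n + 1) → ℕ)) :=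
  (degreeFinset n f d).filter fun x => quotientMonomial M x ∉
    Submodule.span k (quotientMonomial M '' {y | y ∈ degreeFinset n f d ∧
      monomialKey y < monomialKey x})

theorem hilbertFunction_eq_card (d : ℤ) :
    hilbertFunction f M d = (standardMonomials f M d).card := by
  rw [hilbertFunction, quotientPiece_eq_span,
    finrank_span_image_eq_card _ monomialKey monomialKey_injective]
  rfl

theorem shadowSubset_standardMonomials (d : ℤ) :
    ShadowSubset (standardMonomials f M (d + 1)) (standardMonomials f M d) := by
  intro p m i h
  have hdeg : ∀ x : Fin r × (Fin (n + 1) → ℕ), x ∈ degreeFinset n f d ↔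
      (x.1, x.2 + Pi.single i 1) ∈ degreeFinset n f (d + 1) := by
    intro x
    simp only [mem_degreeFinset, Pi.add_apply, Finset.sum_add_distrib, Finset.sum_pi_single',
      Finset.mem_univ, if_true]
    push_cast
    constructor <;> intro h <;> linarith
  have hX : ∀ x : Fin r × (Fin (n + 1) → ℕ), quotientMonomial M (x.1, x.2 + Pi.single i 1) =
      (X i : MvPolynomial (Fin (n + 1)) k) • quotientMonomial M x := by
    intro x
    rw [quotientMonomial, freeMonomial_add_single, map_smul]
    rfl
  simp only [standardMonomials, Finset.mem_filter] at h ⊢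
  refine ⟨(hdeg (p, m)).2 h.1, fun hspan => h.2 ?_⟩
  have := Submodule.mem_map_of_mem (f := Algebra.lsmul k k
    ((Fin r → MvPolynomial (Fin (n + 1)) k) ⧸ M) (X i : MvPolynomial (Fin (n + 1)) k)) hspan
  rw [Submodule.map_span, Algebra.lsmul_coe] at this
  simp only [← hX] at this
  refine Submodule.span_mono ?_ this
  rintro _ ⟨_, ⟨y, ⟨hy, hlt⟩, rfl⟩, rfl⟩
  refine ⟨(y.1, y.2 + Pi.single i 1), ⟨(hdeg y).1 hy, monomialKey_add_lt _ hlt⟩, ?_⟩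
  rw [hX]

theorem hilbertFunction_succ_le (hf : ∀ i, f i ≤ 0) (d : ℕ) (l : List ℕ)
    (hl : l.Pairwise (fun x y => x ≥ y)) (hld : l.length ≤ d)
    (h : hilbertFunction f M d ≤ macaulaySum d l) :
    hilbertFunction f M ((d + 1 : ℕ) : ℤ) ≤ macaulaySum (d + 1) l := by
  rw [hilbertFunction_eq_card] at h ⊢
  have hdeg : ∀ (e : ℕ), ∀ x ∈ standardMonomials f M e, e ≤ ∑ i, x.2 i := by
    intro e x hx
    simp only [standardMonomials, Finset.mem_filter] at hx
    have h1 := mem_degreeFinset.1 hx.1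
    have h2 := hf x.1
    omega
  refine card_le_macaulaySum_succ (n + 1) d l _ _ hl hld ?_ (hdeg (d + 1)) (hdeg d) h
  rw [Nat.cast_succ]
  exact shadowSubset_standardMonomials f M d

theorem exists_isGotzmannRepresentation (hf : ∀ i, f i ≤ 0) :
    ∃ (P : Polynomial ℚ) (a : List ℕ), IsHilbertPolynomial f M P ∧
      IsGotzmannRepresentation P a := by
  obtain ⟨l, hl, d₀, hd₀, h⟩ := exists_eventually_eq_macaulaySum
    (fun d => hilbertFunction f M d) (hilbertFunction_succ_le f M hf)
  refine ⟨_, l, ⟨d₀, fun d hd => ?_⟩, hl, rfl⟩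
  lift d to ℕ using (by omega)
  have hd' : d₀ ≤ d := by exact_mod_cast hd
  have := eval_sum_binomialTerm l (hd₀.trans hd')
  rw [Int.cast_natCast, this, h d hd']

variable {f M} in
theorem IsHilbertPolynomial.unique {P Q : Polynomial ℚ} (hP : IsHilbertPolynomial f M P)
    (hQ : IsHilbertPolynomial f M Q) : P = Q := by
  obtain ⟨d₁, h₁⟩ := hP
  obtain ⟨d₂, h₂⟩ := hQ
  refine Polynomial.eq_of_infinite_eval_eq P Q
    (((Set.Ici_infinite (max d₁ d₂)).image (Int.cast_injective (α := ℚ)).injOn).mono ?_)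
  rintro _ ⟨d, hd, rfl⟩
  have hd' : max d₁ d₂ ≤ d := hd
  exact (h₁ d (by omega)).trans (h₂ d (by omega)).symm

end HilbertFunction

theorem hilbertFunction_bot_eq_card {k : Type*} [Field k] {n r : ℕ} (f : Fin r → ℤ) (d : ℤ) :
    hilbertFunction (k := k) (n := n) f ⊥ d = (degreeFinset n f d).card := by
  have hli : LinearIndependent k (freeMonomial k (n := n) (r := r)) := by
    have := (Pi.basis fun _ : Fin r => basisMonomials (Fin (n + 1)) k).linearIndependent.comp
      (fun x : Fin r × (Fin (n + 1) → ℕ) =>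
        (⟨x.1, Finsupp.equivFunOnFinite.symm x.2⟩ : Σ _ : Fin r, Fin (n + 1) →₀ ℕ)) (by
        rintro ⟨p, m⟩ ⟨q, m'⟩ h
        simpa using h)
    have heq : freeMonomial k (n := n) (r := r) =
        (Pi.basis fun _ : Fin r => basisMonomials (Fin (n + 1)) k) ∘
          fun x => ⟨x.1, Finsupp.equivFunOnFinite.symm x.2⟩ := by
      ext1 x
      simp [freeMonomial, Pi.basis_apply]
    rw [heq]
    exact this
  have hli' := (hli.map' ((⊥ : Submodule (MvPolynomial (Fin (n + 1)) k)
      (Fin r → MvPolynomial (Fin (n + 1)) k)).mkQ.restrictScalars k) (by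
    rw [LinearMap.ker_restrictScalars, Submodule.ker_mkQ]; rfl)).comp
      (fun x : degreeFinset n f d => (x : Fin r × (Fin (n + 1) → ℕ))) Subtype.coe_injective
  rw [hilbertFunction, quotientPiece_eq_span, Set.image_eq_range]
  exact (finrank_span_eq_card hli').trans (Fintype.card_coe _)

theorem isHilbertPolynomial_X (k : Type*) [Field k] :
    IsHilbertPolynomial (fun _ : Fin 1 => (1 : ℤ))
      (⊥ : Submodule (MvPolynomial (Fin (1 + 1)) k) (Fin 1 → MvPolynomial (Fin (1 + 1)) k))
      Polynomial.X := by
  refine ⟨1, fun d hd => ?_⟩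
  lift d to ℕ using (by omega)
  obtain ⟨e, rfl⟩ : ∃ e, d = e + 1 := ⟨d - 1, by omega⟩
  have : degreeFinset 1 (fun _ : Fin 1 => (1 : ℤ)) ((e + 1 : ℕ) : ℤ) =
      (Finset.HasAntidiagonal.antidiagonal e).image fun x => ((0 : Fin 1), ![x.1, x.2]) := by
    ext ⟨p, m⟩
    rw [mem_degreeFinset, show ∑ i, m i = m 0 + m 1 from Fin.sum_univ_two m]
    simp only [Finset.mem_image, Finset.HasAntidiagonal.mem_antidiagonal,
      Prod.mk.injEq, Prod.exists]
    constructor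
    · intro h
      refine ⟨m 0, m 1, by push_cast at h; omega, Subsingleton.elim _ _, ?_⟩
      ext i; fin_cases i <;> rfl
    · rintro ⟨a, b, hab, -, rfl⟩
      simp [← hab]
  rw [hilbertFunction_bot_eq_card, this, Finset.card_image_of_injective,
    Finset.Nat.card_antidiagonal]
  · simp
  · rintro ⟨a, b⟩ ⟨a', b'⟩ h
    simpa using h

end Gotzmann

theorem mainTheorem1 (k : Type*) [Field k] :
    (∀ (n r : ℕ) (f : Fin r → ℤ), (∀ i, f i ≤ 0) →
      ∀ M : Submodule (MvPolynomial (Fin (n + 1)) k) (Fin r → MvPolynomial (Fin (n + 1)) k),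
        Gotzmann.IsGradedSubmodule f M →
          (∃! P : Polynomial ℚ, Gotzmann.IsHilbertPolynomial f M P) ∧
          ∀ P : Polynomial ℚ, Gotzmann.IsHilbertPolynomial f M P →
            ∃! a : List ℕ, Gotzmann.IsGotzmannRepresentation P a) ∧
    -- the free module on one generator of degree `1` over `k[x₀, x₁]`, with sheaf `O(-1)` on `ℙ¹`
    (Gotzmann.IsHilbertPolynomial (fun _ : Fin 1 => (1 : ℤ))
        (⊥ : Submodule (MvPolynomial (Fin (1 + 1)) k) (Fin 1 → MvPolynomial (Fin (1 + 1)) k))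
        Polynomial.X ∧
      ¬ ∃ a : List ℕ, Gotzmann.IsGotzmannRepresentation Polynomial.X a) := by
  refine ⟨fun n r f hf M _ => ?_, Gotzmann.isHilbertPolynomial_X k,
    fun ⟨a, ha⟩ => Gotzmann.not_isGotzmannRepresentation_X a ha⟩
  obtain ⟨P, a, hP, ha⟩ := Gotzmann.exists_isGotzmannRepresentation f M hf
  refine ⟨⟨P, hP, fun Q hQ => hQ.unique hP⟩, fun Q hQ => ?_⟩
  obtain rfl := hQ.unique hP
  exact ⟨a, ha, fun b hb => hb.unique ha⟩
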